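/- Let $d\ge 1$ be an integer. For $t\in\mathbb{C}$ let $$p_t(z)=\sum_{i=1}^d z_i^2+\frac t2\sum_{i\ne j} z_iz_j\in\mathbb{C}[z_1,\dots,z_d],$$ where the second sum runs over all ordered pairs $(i,j)$ with $1\le i,j\le d$ and $i\neq j$. The Schur--Agler norm of a polynomial $p\in\mathbb{C}[z_1,\dots,z_d]$ is $$\|p\|_{\mathrm{SA}}=\sup\{\|p(T_1,\dots,T_d)\| : (T_1,\dots,T_d)\text{ a commuting } d\text{-tuple of contractions on a complex Hilbert space}\}.$$ Let $H^2(\mathbb{D}^d)$ be the Hardy space of all $f(z)=\sum_{\alpha\in\mathbb{N}_0^d}a_\alpha z^\alpha$ with $\|f\|_2^2=\sum_\alpha|a_\alpha|^2<\infty$, with the corresponding inner product $\langle\cdot,\cdot\rangle_2$, and let $M_{z_i}$ be the operator of multiplication by $z_i$ on it. For $g\in H^2(\mathbb{D}^d)$ let $g\otimes g$ be the operator $f\mapsto\langle f,g\rangle_2\, g$. Let $\mathcal{L}_c$ be the set of bounded operators $L\ge 0$ on $H^2(\mathbb{D}^d)$ with $M_{z_i}^*LM_{z_i}\le L$ for $i=1,\dots,d$.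 The dual Schur--Agler norm of $g\in H^2(\mathbb{D}^d)$ is $$\|g\|_*=\inf\big\{\sqrt{\langle L1,1\rangle_2} : L\in\mathcal{L}_c,\ L\ge g\otimes g\big\}.$$ Then for every $t\in\mathbb{C}$: (1) if $d\ge 2$, then $\displaystyle \|p_t\|_{\mathrm{SA}}=d\max\Big\{\Big|1-\frac t2\Big|,\ \Big|1+\frac{t(d-1)}2\Big|\Big\}$; (2) $\displaystyle \|p_t\|_*=\frac{(d-1)|t-1|+|(d-1)t+1|}{d}$. -/

import Mathlib

universe u

open scoped ENNReal

noncomputable section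

/-- The value `p(T) = ∑_α c_α T₁^{α₁} ⋯ T_d^{α_d}` of a polynomial `p = ∑_α c_α z^α` at a `d`-tuple
of elements of a complex algebra. It is only used for tuples of commuting elements, so that the
order of the factors is immaterial. -/
def evalTuple {d : ℕ} {A : Type*} [Ring A] [Algebra ℂ A] (T : Fin d → A)
    (p : MvPolynomial (Fin d) ℂ) : A :=
  ∑ α ∈ p.support, p.coeff α • (List.ofFn fun i => T i ^ α i).prod

/-- The Schur-Agler norm of a polynomial `p` in `d` variables: the supremum of the operator norms
`‖p(T)‖` over all commuting `d`-tuples `T` of contractions on complex Hilbert spaces. -/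
def schurAglerNorm {d : ℕ} (p : MvPolynomial (Fin d) ℂ) : ℝ≥0∞ :=
  ⨆ (H : Type u) (_ : NormedAddCommGroup H) (_ : InnerProductSpace ℂ H) (_ : CompleteSpace H)
    (T : Fin d → H →L[ℂ] H) (_ : ∀ i j, Commute (T i) (T j)) (_ : ∀ i, ‖T i‖ ≤ 1),
    ENNReal.ofReal ‖evalTuple T p‖

/-- The Hardy space `H²(𝔻^d)` of all `f(z) = ∑_α a_α z^α` with `‖f‖₂² = ∑_α |a_α|² < ∞`; an
element `f` is given by its family of Taylor coefficients `a_α = f α`. The inner product is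
`∑_α a_α * conj b_α` (for `inner ℂ g f`, with `g` having the coefficients `b_α`). -/
abbrev HardySpace (d : ℕ) : Type := lp (fun _ : Fin d →₀ ℕ => ℂ) 2

/-- The Taylor coefficients of `z_i * f`. -/
def shiftCoeff {d : ℕ} (i : Fin d) (f : (Fin d →₀ ℕ) → ℂ) (α : Fin d →₀ ℕ) : ℂ :=
  if α i = 0 then 0 else f (α - Finsupp.single i 1)

lemma shiftCoeff_add_single {d : ℕ} (i : Fin d) (f : (Fin d →₀ ℕ) → ℂ) (β : Fin d →₀ ℕ) :
    shiftCoeff i f (β + Finsupp.single i 1) = f β := by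
  simp [shiftCoeff]

lemma shiftCoeff_of_notMem {d : ℕ} (i : Fin d) (f : (Fin d →₀ ℕ) → ℂ) (α : Fin d →₀ ℕ)
    (h : α ∉ Set.range fun β : Fin d →₀ ℕ => β + Finsupp.single i 1) : shiftCoeff i f α = 0 := by
  by_contra hne
  have h0 : α i ≠ 0 := fun h0 => hne (by simp [shiftCoeff, h0])
  exact h ⟨α - Finsupp.single i 1, tsub_add_cancel_of_le
    (Finsupp.single_le_iff.mpr (Nat.one_le_iff_ne_zero.mpr h0))⟩

lemma hasSum_shiftCoeff {d : ℕ} (i : Fin d) (f : HardySpace d) :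
    HasSum (fun α => ‖shiftCoeff i f α‖ ^ (2 : ℝ≥0∞).toReal) (‖f‖ ^ (2 : ℝ≥0∞).toReal) := by
  have hinj : Function.Injective fun β : Fin d →₀ ℕ => β + Finsupp.single i 1 :=
    add_left_injective _
  refine (hinj.hasSum_iff fun α hα => ?_).mp ?_
  · simp [shiftCoeff_of_notMem i f α hα]
  · simpa only [Function.comp_def, shiftCoeff_add_single] using lp.hasSum_norm (by norm_num) f

/-- Multiplication by the coordinate function `z_i` on `H²(𝔻^d)`, as an isometry. -/
def mulZIsometry {d : ℕ} (i : Fin d) : HardySpace d →ₗᵢ[ℂ] HardySpace d where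
  toFun f := ⟨shiftCoeff i f, memℓp_gen (hasSum_shiftCoeff i f).summable⟩
  map_add' f g := by
    ext α
    simp only [lp.coeFn_add, Pi.add_apply, shiftCoeff]
    split_ifs <;> simp
  map_smul' c f := by
    ext α
    simp only [lp.coeFn_smul, Pi.smul_apply, shiftCoeff, RingHom.id_apply]
    split_ifs <;> simp
  norm_map' f := by
    have h := (lp.hasSum_norm (p := 2) (by norm_num) (⟨shiftCoeff i f,
      memℓp_gen (hasSum_shiftCoeff i f).summable⟩ : HardySpace d)).unique (hasSum_shiftCoeff i f)
    exact (Real.rpow_left_inj (norm_nonneg _) (norm_nonneg _) (by norm_num)).mp h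

/-- The operator `M_{z_i}` of multiplication by `z_i` on `H²(𝔻^d)`. -/
def mulZ {d : ℕ} (i : Fin d) : HardySpace d →L[ℂ] HardySpace d :=
  (mulZIsometry i).toContinuousLinearMap

/-- A polynomial, viewed as an element of `H²(𝔻^d)`. -/
def polyToHardy {d : ℕ} (p : MvPolynomial (Fin d) ℂ) : HardySpace d :=
  ⟨fun α => p.coeff α, memℓp_gen (summable_of_ne_finset_zero (s := p.support) fun α hα => by
    simp [MvPolynomial.notMem_support_iff.mp hα])⟩

/-- The cone `𝓛_c` of bounded operators `L ≥ 0` on `H²(𝔻^d)` with `M_{z_i}^* L M_{z_i} ≤ L` for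
all `i`, in the Loewner order. -/
def coneLc (d : ℕ) : Set (HardySpace d →L[ℂ] HardySpace d) :=
  {L | 0 ≤ L ∧ ∀ i, (mulZ i).adjoint ∘L L ∘L mulZ i ≤ L}

/-- The set `𝓛_c(g)` of all `L ∈ 𝓛_c` with `L ≥ g ⊗ g`, where `(g ⊗ g) f = ⟨f, g⟩ g`. -/
def coneLcAbove {d : ℕ} (g : HardySpace d) : Set (HardySpace d →L[ℂ] HardySpace d) :=
  {L | L ∈ coneLc d ∧ InnerProductSpace.rankOne ℂ g g ≤ L}

/-- The dual Schur-Agler norm `‖g‖_* = inf {√⟨L 1, 1⟩ : L ∈ 𝓛_c(g)}` of `g ∈ H²(𝔻^d)`. -/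
def dualSchurAglerNorm {d : ℕ} (g : HardySpace d) : ℝ :=
  sInf ((fun L : HardySpace d →L[ℂ] HardySpace d =>
    √(RCLike.re (inner ℂ (L (polyToHardy 1)) (polyToHardy 1)))) '' coneLcAbove g)

open scoped ComplexOrder in
/-- The infimum defining `‖g‖_*` is over a nonempty set: `‖g‖₂² I ∈ 𝓛_c(g)`. -/
lemma coneLcAbove_nonempty {d : ℕ} (g : HardySpace d) : (coneLcAbove g).Nonempty := by
  have hM : ∀ i : Fin d, (mulZ i).adjoint ∘L mulZ i = 1 := fun i => by
    refine ContinuousLinearMap.ext fun f => ext_inner_right ℂ fun h => ?_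
    rw [ContinuousLinearMap.comp_apply, ContinuousLinearMap.adjoint_inner_left]
    exact (mulZIsometry i).inner_map_map f h
  have hc : (0 : ℂ) ≤ ((‖g‖ ^ 2 : ℝ) : ℂ) := by exact_mod_cast sq_nonneg ‖g‖
  refine ⟨((‖g‖ ^ 2 : ℝ) : ℂ) • 1, ⟨?_, fun i => le_of_eq ?_⟩, ?_⟩
  · rw [ContinuousLinearMap.nonneg_iff_isPositive]
    exact ContinuousLinearMap.isPositive_one.smul_of_nonneg hc
  · rw [ContinuousLinearMap.smul_comp, ContinuousLinearMap.comp_smul,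
      ContinuousLinearMap.one_def, ContinuousLinearMap.id_comp, hM i, ContinuousLinearMap.one_def]
  · rw [ContinuousLinearMap.le_def, ContinuousLinearMap.isPositive_def']
    refine ⟨?_, fun f => ?_⟩
    · refine IsSelfAdjoint.sub ?_ ?_
      · exact (ContinuousLinearMap.isPositive_one.smul_of_nonneg hc).isSelfAdjoint
      · rw [ContinuousLinearMap.isSelfAdjoint_iff', InnerProductSpace.adjoint_rankOne]
    · have h1 : ‖(inner ℂ g f : ℂ)‖ ^ 2 ≤ ‖g‖ ^ 2 * ‖f‖ ^ 2 := by
        rw [← mul_pow]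
        exact pow_le_pow_left₀ (norm_nonneg _) (norm_inner_le_norm g f) 2
      have h2 : inner ℂ f f = ((‖f‖ ^ 2 : ℝ) : ℂ) := by
        simp
      have h3 : (starRingEnd ℂ) (inner ℂ g f) * inner ℂ g f
          = ((‖(inner ℂ g f : ℂ)‖ ^ 2 : ℝ) : ℂ) := by
        rw [Complex.conj_mul']; push_cast; rfl
      simp only [ContinuousLinearMap.reApplyInnerSelf_apply, sub_apply,
        smul_apply, one_apply_eq_self, inner_sub_left,
        InnerProductSpace.rankOne_apply, inner_smul_left, Complex.conj_ofReal, h2, h3]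
      rw [← Complex.ofReal_mul, ← Complex.ofReal_sub, RCLike.re_eq_complex_re, Complex.ofReal_re]
      exact sub_nonneg.mpr h1

/-- The polynomial `p_t = ∑_i z_i² + (t/2) ∑_{i ≠ j} z_i z_j`, where the second sum is over ordered
pairs `(i, j)`. -/
def kvhPoly (d : ℕ) (t : ℂ) : MvPolynomial (Fin d) ℂ :=
  ∑ i, MvPolynomial.X i ^ 2 +
    MvPolynomial.C (t / 2) * ∑ ij ∈ (Finset.univ : Finset (Fin d)).offDiag,
      MvPolynomial.X ij.1 * MvPolynomial.X ij.2

end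

/-! Write `p_t = ∑ z_i (α z_i + κ ∑ z_j)` with `α = 1 - t/2`, `κ = t/2`. The matrix `α + κJ`, with
`J` the all-ones matrix, has the eigenvalues `α` and `α + dκ`, and Cauchy–Schwarz bounds the
Schur–Agler norm by `d` times the larger modulus. The all-identity tuple attains the value for `α +
dκ`. For `α`, commuting two-step nilpotents are built from unit vectors `u_i` with zero sum and
symmetric inner products.

For the dual norm, `L ≥ 0` defines the seminorm `‖R f‖`, for which each `M_{z_i}` is a contraction,
so the same estimate applies to `q = ∑ z_i (α z_i + κ ∑ z_j)`. Pairing `p_t` with a `q` whose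
eigenvalues are suitable phases gives the lower bound (`le_sqrt_of_mem_coneLcAbove`). An explicit
operator, `p_t ⊗ p_t` plus terms in degrees one and zero, attains it
(`exists_mem_coneLcAbove_sqrt_eq`). -/

theorem ContinuousLinearMap.exists_norm_sq_eq_of_nonneg {H : Type*} [NormedAddCommGroup H]
    [InnerProductSpace ℂ H] [CompleteSpace H] {L : H →L[ℂ] H} (hL : 0 ≤ L) :
    ∃ R : H →L[ℂ] H, ∀ x, RCLike.re (inner ℂ (L x) x) = ‖R x‖ ^ 2 := by
  obtain ⟨R, hR⟩ := CStarAlgebra.nonneg_iff_eq_star_mul_self.1 hL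
  refine ⟨R, fun x => ?_⟩
  rw [hR, ContinuousLinearMap.star_eq_adjoint]
  change RCLike.re (inner ℂ (R.adjoint (R x)) x) = _
  rw [ContinuousLinearMap.adjoint_inner_left, inner_self_eq_norm_sq]

/-! ### Norm bounds for `α + κJ` acting on tuples of vectors. -/

section VectorInequalities

variable {H : Type*} [NormedAddCommGroup H] [InnerProductSpace ℂ H] {d : ℕ}

/-- Tuples of zero sum are orthogonal to constant tuples, so the cross terms cancel. -/
lemma sum_norm_sq_smul_add_smul (x : Fin d → H) (hx : ∑ i, x i = 0) (y : H) (a b : ℂ) :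
    ∑ i, ‖a • x i + b • y‖ ^ 2 = ‖a‖ ^ 2 * ∑ i, ‖x i‖ ^ 2 + d * (‖b‖ ^ 2 * ‖y‖ ^ 2) := by
  have h : ∑ i, RCLike.re (inner ℂ (a • x i) (b • y)) = 0 := by
    rw [← map_sum, ← sum_inner, ← Finset.smul_sum, hx]
    simp
  simp only [@norm_add_sq ℂ, Finset.sum_add_distrib, ← Finset.mul_sum, h, norm_smul, mul_pow]
  simp [mul_left_comm]

lemma sum_sub_mean (hd : d ≠ 0) (v : Fin d → H) :
    ∑ i, (v i - (d : ℂ)⁻¹ • ∑ j, v j) = 0 := by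
  have hd' : (d : ℂ) ≠ 0 := by exact_mod_cast hd
  rw [Finset.sum_sub_distrib, Finset.sum_const, Finset.card_univ, Fintype.card_fin,
    ← Nat.cast_smul_eq_nsmul ℂ, smul_smul, mul_inv_cancel₀ hd', one_smul, sub_self]

/-- The operator `α + κ J` on tuples, where `J` is the all-ones matrix, has norm at most `m` if its
eigenvalues `α` and `α + d κ` do. -/
lemma sum_norm_sq_smul_add_smul_sum_le (hd : d ≠ 0) (v : Fin d → H) {α κ : ℂ} {m : ℝ}
    (hα : ‖α‖ ≤ m) (hβ : ‖α + d * κ‖ ≤ m) :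
    ∑ i, ‖α • v i + κ • ∑ j, v j‖ ^ 2 ≤ m ^ 2 * ∑ i, ‖v i‖ ^ 2 := by
  have hd' : (d : ℂ) ≠ 0 := by exact_mod_cast hd
  have hx := sum_sub_mean hd v
  set y := (d : ℂ)⁻¹ • ∑ j, v j with hy
  have hs : ∑ j, v j = (d : ℂ) • y := by rw [hy, smul_smul, mul_inv_cancel₀ hd', one_smul]
  have h1 : ∀ i, α • v i + κ • ∑ j, v j = α • (v i - y) + (α + d * κ) • y := fun i => by
    rw [hs]; module
  have h2 : ∑ i, ‖v i‖ ^ 2 = ∑ i, ‖v i - y‖ ^ 2 + d * ‖y‖ ^ 2 := by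
    simpa using sum_norm_sq_smul_add_smul (fun i => v i - y) hx y 1 1
  simp only [h1, h2, sum_norm_sq_smul_add_smul _ hx]
  have h3 : ‖α‖ ^ 2 ≤ m ^ 2 := pow_le_pow_left₀ (norm_nonneg _) hα 2
  have h4 : ‖α + d * κ‖ ^ 2 ≤ m ^ 2 := pow_le_pow_left₀ (norm_nonneg _) hβ 2
  calc _ ≤ m ^ 2 * ∑ i, ‖v i - y‖ ^ 2 + d * (m ^ 2 * ‖y‖ ^ 2) := by gcongr
    _ = _ := by ring

/-- Serves both norms: it is applied to `v i = T i x` and to `v i = R (hardyX i)`. -/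
lemma sum_norm_smul_add_smul_sum_le (hd : d ≠ 0) (v : Fin d → H) {α κ : ℂ} {m C : ℝ}
    (hα : ‖α‖ ≤ m) (hβ : ‖α + d * κ‖ ≤ m) (hC : 0 ≤ C) (hv : ∀ i, ‖v i‖ ≤ C) :
    ∑ i, ‖α • v i + κ • ∑ j, v j‖ ≤ d * m * C := by
  have hm : 0 ≤ m := (norm_nonneg _).trans hα
  refine le_of_sq_le_sq ?_ (by positivity)
  calc (∑ i, ‖α • v i + κ • ∑ j, v j‖) ^ 2
      ≤ d * ∑ i, ‖α • v i + κ • ∑ j, v j‖ ^ 2 := by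
        simpa using sq_sum_le_card_mul_sum_sq (s := Finset.univ)
          (f := fun i => ‖α • v i + κ • ∑ j, v j‖)
    _ ≤ d * (m ^ 2 * ∑ i, ‖v i‖ ^ 2) := by
        gcongr; exact sum_norm_sq_smul_add_smul_sum_le hd v hα hβ
    _ ≤ d * (m ^ 2 * ∑ _i : Fin d, C ^ 2) := by
        gcongr with i; exact hv i
    _ = (d * m * C) ^ 2 := by simp; ring

end VectorInequalities

/-! ### Evaluation of polynomials at commuting tuples. -/

section Evaluation

open scoped IsMulCommutative in
-- The subalgebra generated by the `T i` is commutative, so `MvPolynomial.aeval` is available there.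
lemma exists_algHom_eq_evalTuple {d : ℕ} {A : Type*} [Ring A] [Algebra ℂ A] (T : Fin d → A)
    (hT : ∀ i j, Commute (T i) (T j)) :
    ∃ φ : MvPolynomial (Fin d) ℂ →ₐ[ℂ] A, (∀ i, φ (MvPolynomial.X i) = T i) ∧
      ∀ p, evalTuple T p = φ p := by
  have hcomm : ∀ a ∈ Set.range T, ∀ b ∈ Set.range T, a * b = b * a := by
    rintro _ ⟨i, rfl⟩ _ ⟨j, rfl⟩
    exact hT i j
  have := Algebra.isMulCommutative_adjoin ℂ hcomm
  let S : Fin d → Algebra.adjoin ℂ (Set.range T) := fun i =>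
    ⟨T i, Algebra.subset_adjoin ⟨i, rfl⟩⟩
  refine ⟨(Algebra.adjoin ℂ (Set.range T)).val.comp (MvPolynomial.aeval S),
    fun i => by simp [S], fun p => ?_⟩
  rw [AlgHom.comp_apply, MvPolynomial.aeval_def, MvPolynomial.eval₂_eq', map_sum]
  refine Finset.sum_congr rfl fun α _ => ?_
  rw [← List.prod_ofFn, ← Algebra.smul_def, map_smul, map_list_prod, List.map_ofFn]
  rfl

lemma kvhPoly_eq (d : ℕ) (t : ℂ) :
    kvhPoly d t = ∑ i, MvPolynomial.X i *
      ((1 - t / 2) • MvPolynomial.X i + (t / 2) • ∑ j, MvPolynomial.X j) := by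
  have h : ∑ ij ∈ (Finset.univ : Finset (Fin d)).offDiag,
      (MvPolynomial.X ij.1 * MvPolynomial.X ij.2 : MvPolynomial (Fin d) ℂ) =
      (∑ i, MvPolynomial.X i) * (∑ i, MvPolynomial.X i) - ∑ i, MvPolynomial.X i ^ 2 := by
    rw [Finset.sum_mul_sum, ← Finset.sum_product', ← Finset.diag_union_offDiag,
      Finset.sum_union (Finset.disjoint_diag_offDiag _), Finset.sum_diag]
    simp [sq]
  simp only [kvhPoly, h, MvPolynomial.smul_eq_C_mul, mul_add, Finset.sum_add_distrib, map_sub,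
    map_one]
  simp only [sub_mul, mul_sub, Finset.sum_sub_distrib, one_mul, ← Finset.sum_mul,
    mul_left_comm (MvPolynomial.X _) (MvPolynomial.C _), ← Finset.mul_sum, sq]
  ring

lemma evalTuple_kvhPoly {d : ℕ} {A : Type*} [Ring A] [Algebra ℂ A] (T : Fin d → A)
    (hT : ∀ i j, Commute (T i) (T j)) (t : ℂ) :
    evalTuple T (kvhPoly d t) = ∑ i, T i * ((1 - t / 2) • T i + (t / 2) • ∑ j, T j) := by
  obtain ⟨φ, hφ, h⟩ := exists_algHom_eq_evalTuple T hT
  simp [h, kvhPoly_eq, hφ]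

end Evaluation

/-! ### The Schur–Agler norm. -/

section SchurAgler

lemma le_schurAglerNorm {d : ℕ} (p : MvPolynomial (Fin d) ℂ) {H : Type u} [NormedAddCommGroup H]
    [InnerProductSpace ℂ H] [CompleteSpace H] (T : Fin d → H →L[ℂ] H)
    (hT : ∀ i j, Commute (T i) (T j)) (hT1 : ∀ i, ‖T i‖ ≤ 1) :
    ENNReal.ofReal ‖evalTuple T p‖ ≤ schurAglerNorm.{u} p := by
  unfold schurAglerNorm
  exact le_iSup_of_le H <| le_iSup_of_le inferInstance <|
    le_iSup_of_le inferInstance <| le_iSup_of_le inferInstance <| le_iSup_of_le T <| le_iSup_of_le hT <| le_iSup_of_le hT1 le_rfl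

lemma schurAglerNorm_kvhPoly_le {d : ℕ} (hd : d ≠ 0) (t : ℂ) :
    schurAglerNorm.{u} (kvhPoly d t) ≤
      ENNReal.ofReal (d * max ‖1 - t / 2‖ ‖1 + t * (d - 1) / 2‖) := by
  refine iSup_le fun H => iSup_le fun _ => iSup_le fun _ => iSup_le fun _ => iSup_le fun T =>
    iSup_le fun hT => iSup_le fun hT1 => ENNReal.ofReal_le_ofReal ?_
  rw [evalTuple_kvhPoly T hT]
  refine ContinuousLinearMap.opNorm_le_bound _ (by positivity) fun x => ?_
  have hβ : 1 - t / 2 + d * (t / 2) = 1 + t * (d - 1) / 2 := by ring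
  calc ‖(∑ i, T i * ((1 - t / 2) • T i + (t / 2) • ∑ j, T j)) x‖
      = ‖∑ i, T i ((1 - t / 2) • T i x + (t / 2) • ∑ j, T j x)‖ := by
        simp [sum_apply]
    _ ≤ ∑ i, ‖(1 - t / 2) • T i x + (t / 2) • ∑ j, T j x‖ :=
        norm_sum_le_of_le _ fun i _ => (T i).le_of_opNorm_le (hT1 i) _ |>.trans_eq (one_mul _)
    _ ≤ _ := sum_norm_smul_add_smul_sum_le hd (fun i => T i x) (le_max_left _ _)
        (hβ ▸ le_max_right _ _) (norm_nonneg x)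
        fun i => ((T i).le_of_opNorm_le (hT1 i) _).trans_eq (one_mul _)

lemma norm_add_mul_le_schurAglerNorm {d : ℕ} (t : ℂ) :
    ENNReal.ofReal (d * ‖1 + t * (d - 1) / 2‖) ≤ schurAglerNorm.{u} (kvhPoly d t) := by
  let H := EuclideanSpace ℂ (ULift.{u} (Fin 1))
  have h := le_schurAglerNorm.{u} (kvhPoly d t) (fun _ => (1 : H →L[ℂ] H))
    (fun _ _ => Commute.refl _) fun _ => ContinuousLinearMap.norm_id_le
  rw [evalTuple_kvhPoly _ fun _ _ => Commute.refl _] at h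
  convert h using 2
  have : ∑ i : Fin d, (1 : H →L[ℂ] H) * ((1 - t / 2) • 1 + (t / 2) • ∑ j : Fin d, 1) =
      ((d : ℂ) * (1 + t * (d - 1) / 2)) • 1 := by
    simp only [Finset.sum_const, Finset.card_univ, Fintype.card_fin, one_mul,
      ← Nat.cast_smul_eq_nsmul ℂ]
    module
  rw [this, norm_smul, norm_mul, norm_one, mul_one, Complex.norm_natCast]

open InnerProductSpace in
/-- A nilpotent operator sending `e` to `u` and `u` to `f`. -/
noncomputable def twoStep {H : Type*} [NormedAddCommGroup H] [InnerProductSpace ℂ H] (e f u : H) :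
    H →L[ℂ] H :=
  rankOne ℂ u e + rankOne ℂ f u

section TwoStep

variable {H : Type*} [NormedAddCommGroup H] [InnerProductSpace ℂ H] {e f : H}

open InnerProductSpace in
lemma twoStep_mul_twoStep {u v : H} (hef : inner ℂ e f = 0) (hev : inner ℂ e v = 0)
    (huf : inner ℂ u f = 0) :
    twoStep e f u * twoStep e f v = inner ℂ u v • rankOne ℂ f e := by
  ext x
  simp [twoStep, inner_add_right, inner_smul_right, hef, hev, huf, smul_smul, mul_comm]

/-- The orthonormal pair `e, u` goes to the orthonormal pair `u, f`, and Bessel's inequality gives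
the bound. -/
lemma norm_twoStep_le {u : H} (he : ‖e‖ = 1) (hf : ‖f‖ = 1) (hu : ‖u‖ = 1)
    (heu : inner ℂ e u = 0) (huf : inner ℂ u f = 0) : ‖twoStep e f u‖ ≤ 1 := by
  refine ContinuousLinearMap.opNorm_le_bound _ zero_le_one fun x => ?_
  rw [one_mul]
  refine le_of_sq_le_sq ?_ (norm_nonneg _)
  have ho : Orthonormal ℂ ![e, u] := by
    rw [orthonormal_vecCons_iff]
    simp [he, hu, heu]
  have hb := ho.sum_inner_products_le x (s := Finset.univ)
  have hn : ‖twoStep e f u x‖ ^ 2 = ‖inner ℂ e x‖ ^ 2 + ‖inner ℂ u x‖ ^ 2 := by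
    simp [twoStep, @norm_add_sq ℂ, norm_smul, hf, hu, inner_smul_left, inner_smul_right, huf]
  rw [hn]
  simpa using hb

/-- Products of these operators are `⟨u_i, u_j⟩ f ⊗ e`. Symmetry of the inner products makes them
commute, and the zero sum kills the `J` part, leaving the eigenvalue `1 - t/2`. -/
lemma norm_mul_le_schurAglerNorm_of_sum_eq_zero {d : ℕ} {H : Type u} [NormedAddCommGroup H]
    [InnerProductSpace ℂ H] [CompleteSpace H] {e f : H} (u : Fin d → H) (t : ℂ)
    (he : ‖e‖ = 1) (hf : ‖f‖ = 1) (hef : inner ℂ e f = 0)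
    (hu : ∀ i, ‖u i‖ = 1) (heu : ∀ i, inner ℂ e (u i) = 0) (huf : ∀ i, inner ℂ (u i) f = 0)
    (huu : ∀ i j, inner ℂ (u i) (u j) = inner ℂ (u j) (u i)) (hsum : ∑ i, u i = 0) :
    ENNReal.ofReal (d * ‖1 - t / 2‖) ≤ schurAglerNorm.{u} (kvhPoly d t) := by
  have hT : ∀ i j, Commute (twoStep e f (u i)) (twoStep e f (u j)) := fun i j => by
    rw [Commute, SemiconjBy, twoStep_mul_twoStep hef (heu j) (huf i),
      twoStep_mul_twoStep hef (heu i) (huf j), huu]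
  have h := le_schurAglerNorm.{u} (kvhPoly d t) _ hT fun i =>
    norm_twoStep_le he hf (hu i) (heu i) (huf i)
  rw [evalTuple_kvhPoly _ hT] at h
  convert h using 2
  have : ∑ i, twoStep e f (u i) * ((1 - t / 2) • twoStep e f (u i) +
      (t / 2) • ∑ j, twoStep e f (u j)) =
      ((d : ℂ) * (1 - t / 2)) • InnerProductSpace.rankOne ℂ f e := by
    have h1 : ∀ i, twoStep e f (u i) * twoStep e f (u i) = InnerProductSpace.rankOne ℂ f e :=
      fun i => by
        rw [twoStep_mul_twoStep hef (heu i) (huf i), inner_self_eq_norm_sq_to_K, hu i]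
        simp
    have h2 : ∀ i, twoStep e f (u i) * ∑ j, twoStep e f (u j) = 0 := fun i => by
      rw [Finset.mul_sum]
      simp only [twoStep_mul_twoStep hef (heu _) (huf i), ← Finset.sum_smul, ← inner_sum, hsum]
      simp
    simp only [mul_add, mul_smul_comm, h1, h2, smul_zero, add_zero, Finset.sum_const,
      Finset.card_univ, Fintype.card_fin, ← Nat.cast_smul_eq_nsmul ℂ, smul_smul]
  rw [this, norm_smul, InnerProductSpace.norm_rankOne, he, hf, norm_mul, Complex.norm_natCast]
  simp

end TwoStep

lemma norm_sub_le_schurAglerNorm {d : ℕ} (hd : 2 ≤ d) (t : ℂ) :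
    ENNReal.ofReal (d * ‖1 - t / 2‖) ≤ schurAglerNorm.{u} (kvhPoly d t) := by
  let b : OrthonormalBasis _ ℂ (EuclideanSpace ℂ (ULift.{u} (Fin 4))) :=
    EuclideanSpace.basisFun _ ℂ
  let v : Fin 4 → EuclideanSpace ℂ (ULift.{u} (Fin 4)) := fun k => b ⟨k⟩
  have hv : Orthonormal ℂ v := b.orthonormal.comp _ ULift.up_injective
  have hin : ∀ k l, inner ℂ (v k) (v l) = if k = l then 1 else 0 :=
    orthonormal_iff_ite.1 hv
  -- The `d`-th roots of unity sum to zero because `d ≥ 2`. They are then read as vectors in a real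
  -- plane, so that their inner products are real, hence symmetric.
  obtain ⟨z, hz, hz0⟩ : ∃ z : Fin d → ℂ, (∀ i, ‖z i‖ = 1) ∧ ∑ i, z i = 0 := by
    have hζ := Complex.isPrimitiveRoot_exp d (by omega)
    refine ⟨fun i => Complex.exp (2 * Real.pi * Complex.I / d) ^ (i : ℕ), fun i => ?_, ?_⟩
    · rw [norm_pow, hζ.norm'_eq_one (by omega), one_pow]
    · rw [Fin.sum_univ_eq_sum_range]
      exact hζ.geom_sum_eq_zero (by omega)
  have hre : ∑ i, ((z i).re : ℂ) = 0 := by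
    rw [← Complex.ofReal_sum, ← Complex.re_sum, hz0]; simp
  have him : ∑ i, ((z i).im : ℂ) = 0 := by
    rw [← Complex.ofReal_sum, ← Complex.im_sum, hz0]; simp
  let u : Fin d → EuclideanSpace ℂ (ULift.{u} (Fin 4)) := fun i =>
    ((z i).re : ℂ) • v 2 + ((z i).im : ℂ) • v 3
  have huu : ∀ i j, inner ℂ (u i) (u j) =
      (((z i).re * (z j).re + (z i).im * (z j).im : ℝ) : ℂ) := fun i j => by
    simp [u, inner_add_left, inner_add_right, inner_smul_left, inner_smul_right, hin, hv.1, mul_comm]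
  refine norm_mul_le_schurAglerNorm_of_sum_eq_zero (e := v 0) (f := v 1) u t (hv.1 0) (hv.1 1)
    (by simp [hin]) (fun i => ?_) (fun i => ?_) (fun i => ?_) (fun i j => ?_) ?_
  · have h : ‖u i‖ ^ 2 = 1 ^ 2 := by
      rw [← inner_self_eq_norm_sq (𝕜 := ℂ), huu, ← Complex.normSq_apply, Complex.normSq_eq_norm_sq,
        hz]
      exact Complex.ofReal_re _
    exact (pow_left_inj₀ (norm_nonneg _) zero_le_one two_ne_zero).1 h
  · simp [u, inner_add_right, inner_smul_right, hin]
  · simp [u, inner_add_left, inner_smul_left, hin]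
  · rw [huu, huu]; congr 1; ring
  · simp only [u, Finset.sum_add_distrib, ← Finset.sum_smul, hre, him]
    simp

lemma schurAglerNorm_kvhPoly {d : ℕ} (hd : 2 ≤ d) (t : ℂ) :
    schurAglerNorm.{u} (kvhPoly d t) =
      ENNReal.ofReal (d * max ‖1 - t / 2‖ ‖1 + t * (d - 1) / 2‖) := by
  refine le_antisymm (schurAglerNorm_kvhPoly_le (by omega) t) ?_
  rcases max_cases ‖1 - t / 2‖ ‖1 + t * (d - 1) / 2‖ with h | h <;> rw [h.1]
  exacts [norm_sub_le_schurAglerNorm hd t, norm_add_mul_le_schurAglerNorm t]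

end SchurAgler

/-! ### Coefficients and inner products in the Hardy space. -/

section Hardy

variable {d : ℕ}

/-- The linear map `polyToHardy`. -/
noncomputable def polyToHardyLinear (d : ℕ) : MvPolynomial (Fin d) ℂ →ₗ[ℂ] HardySpace d where
  toFun := polyToHardy
  map_add' p q := by ext α; exact MvPolynomial.coeff_add α p q
  map_smul' c p := by ext α; exact MvPolynomial.coeff_smul α c p

lemma polyToHardy_X_mul (i : Fin d) (p : MvPolynomial (Fin d) ℂ) :
    polyToHardy (MvPolynomial.X i * p) = mulZ i (polyToHardy p) := by
  ext α
  change MvPolynomial.coeff α (MvPolynomial.X i * p) = shiftCoeff i (fun β => p.coeff β) α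
  rw [MvPolynomial.coeff_X_mul', shiftCoeff]
  by_cases h : α i = 0 <;> simp [h]

/-- The coordinate function `z_i` in the Hardy space. -/
noncomputable def hardyX (i : Fin d) : HardySpace d := mulZ i (polyToHardy 1)

lemma polyToHardy_X (i : Fin d) : polyToHardy (MvPolynomial.X i) = hardyX i := by
  rw [hardyX, ← polyToHardy_X_mul, mul_one]

/-- The element `∑_i z_i (α z_i + κ ∑_j z_j)` of the Hardy space. -/
noncomputable def hardyQuadratic (d : ℕ) (α κ : ℂ) : HardySpace d :=
  ∑ i, mulZ i (α • hardyX i + κ • ∑ j, hardyX j)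

lemma polyToHardy_kvhPoly (t : ℂ) :
    polyToHardy (kvhPoly d t) = hardyQuadratic d (1 - t / 2) (t / 2) := by
  change polyToHardyLinear d (kvhPoly d t) = _
  rw [kvhPoly_eq, map_sum]
  refine Finset.sum_congr rfl fun i _ => ?_
  change polyToHardy (MvPolynomial.X i * _) = _
  rw [polyToHardy_X_mul]
  congr 1
  change polyToHardyLinear d _ = _
  simp only [map_add, map_smul, map_sum]
  simp only [← polyToHardy_X]
  rfl

lemma mulZ_single (i : Fin d) (α : Fin d →₀ ℕ) :
    mulZ i (lp.single 2 α (1 : ℂ)) = lp.single 2 (α + Finsupp.single i 1) (1 : ℂ) := by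
  ext β
  change shiftCoeff i (lp.single 2 α (1 : ℂ) : HardySpace d) β = _
  by_cases hβ : β ∈ Set.range fun γ : Fin d →₀ ℕ => γ + Finsupp.single i 1
  · obtain ⟨γ, rfl⟩ := hβ
    rw [shiftCoeff_add_single]
    simp [Pi.single_apply]
  · rw [shiftCoeff_of_notMem _ _ _ hβ]
    have : β ≠ α + Finsupp.single i 1 := fun h => hβ ⟨α, h.symm⟩
    simp [this]

lemma polyToHardy_one : (polyToHardy 1 : HardySpace d) = lp.single 2 0 (1 : ℂ) := by
  ext β
  change MvPolynomial.coeff β 1 = _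
  simp [MvPolynomial.coeff_one, Pi.single_apply, eq_comm]

lemma hardyX_eq (i : Fin d) : hardyX i = lp.single 2 (Finsupp.single i 1) (1 : ℂ) := by
  rw [hardyX, polyToHardy_one, mulZ_single, zero_add]

lemma inner_one_left (f : HardySpace d) : inner ℂ (polyToHardy 1) f = f 0 := by
  rw [polyToHardy_one, lp.inner_single_left]; simp

lemma inner_hardyX_left (i : Fin d) (f : HardySpace d) :
    inner ℂ (hardyX i) f = f (Finsupp.single i 1) := by
  rw [hardyX_eq, lp.inner_single_left]; simp

lemma inner_mulZ_hardyX_left (i j : Fin d) (f : HardySpace d) :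
    inner ℂ (mulZ i (hardyX j)) f = f (Finsupp.single j 1 + Finsupp.single i 1) := by
  rw [hardyX_eq, mulZ_single, lp.inner_single_left]; simp

lemma mulZ_apply (i : Fin d) (f : HardySpace d) (α : Fin d →₀ ℕ) :
    mulZ i f α = shiftCoeff i f α := rfl

lemma inner_one_mulZ (i : Fin d) (f : HardySpace d) :
    inner ℂ (polyToHardy 1) (mulZ i f) = 0 := by
  rw [inner_one_left, mulZ_apply]; simp [shiftCoeff]

lemma inner_hardyX_mulZ (i j : Fin d) (f : HardySpace d) :
    inner ℂ (hardyX j) (mulZ i f) = if j = i then f 0 else 0 := by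
  rw [inner_hardyX_left, mulZ_apply, shiftCoeff]
  by_cases h : j = i
  · simp [h]
  · simp [h]

/-- The subtracted term corrects the double count when `a = b = i`. -/
lemma mulZ_single_add_single (i a b : Fin d) (f : HardySpace d) :
    mulZ i f (Finsupp.single b 1 + Finsupp.single a 1) =
      (if a = i then f (Finsupp.single b 1) else 0) +
        (if b = i then f (Finsupp.single a 1) else 0) -
        (if a = i then if b = i then f (Finsupp.single i 1) else 0 else 0) := by
  rw [mulZ_apply]
  by_cases ha : a = i
  · subst ha
    rw [shiftCoeff_add_single]
    by_cases hb : b = a <;> simp [hb]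
  · by_cases hb : b = i
    · subst hb
      rw [add_comm, shiftCoeff_add_single]
      simp [ha]
    · simp [shiftCoeff, ha, hb]

lemma inner_hardyQuadratic_mulZ (α κ : ℂ) (i : Fin d) (f : HardySpace d) :
    inner ℂ (hardyQuadratic d α κ) (mulZ i f) =
      starRingEnd ℂ (α - κ) * f (Finsupp.single i 1) +
        starRingEnd ℂ (2 * κ) * ∑ j, f (Finsupp.single j 1) := by
  simp only [hardyQuadratic, map_add, map_smul, map_sum, sum_inner, inner_add_left,
    inner_smul_left, inner_mulZ_hardyX_left, mulZ_single_add_single]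
  simp only [Finset.sum_add_distrib, Finset.sum_sub_distrib, ← Finset.mul_sum,
    Finset.sum_ite_eq', Finset.mem_univ, if_true, map_sub, map_mul, Finset.sum_ite_irrel,
    Finset.sum_const_zero, map_ofNat]
  ring

/-! ### Lower bound for the dual norm. -/

lemma re_inner_rankOne_self {H : Type*} [NormedAddCommGroup H] [InnerProductSpace ℂ H] (g f : H) :
    RCLike.re (inner ℂ (InnerProductSpace.rankOne ℂ g g f) f) = ‖inner ℂ g f‖ ^ 2 := by
  rw [InnerProductSpace.rankOne_apply, inner_smul_left, Complex.conj_mul', ← Complex.ofReal_pow]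
  exact Complex.ofReal_re _

lemma norm_inner_sq_le_of_rankOne_le {g : HardySpace d} {L : HardySpace d →L[ℂ] HardySpace d}
    (h : InnerProductSpace.rankOne ℂ g g ≤ L) (f : HardySpace d) :
    ‖inner ℂ g f‖ ^ 2 ≤ RCLike.re (inner ℂ (L f) f) := by
  rw [ContinuousLinearMap.le_def] at h
  have := h.re_inner_nonneg_left f
  rw [sub_apply, inner_sub_left, map_sub, sub_nonneg] at this
  rwa [re_inner_rankOne_self] at this

lemma re_inner_mulZ_le_of_mem_coneLc {L : HardySpace d →L[ℂ] HardySpace d} (h : L ∈ coneLc d)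
    (i : Fin d) (f : HardySpace d) :
    RCLike.re (inner ℂ (L (mulZ i f)) (mulZ i f)) ≤ RCLike.re (inner ℂ (L f) f) := by
  have := h.2 i
  rw [ContinuousLinearMap.le_def] at this
  have := this.re_inner_nonneg_left f
  rwa [sub_apply, inner_sub_left, map_sub, sub_nonneg, ContinuousLinearMap.comp_apply,
    ContinuousLinearMap.adjoint_inner_left] at this

lemma norm_inner_hardyQuadratic_le (hd : d ≠ 0) {g : HardySpace d}
    {L : HardySpace d →L[ℂ] HardySpace d} (hL : L ∈ coneLcAbove g) {α κ : ℂ} {m : ℝ}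
    (hα : ‖α‖ ≤ m) (hβ : ‖α + d * κ‖ ≤ m) :
    ‖inner ℂ g (hardyQuadratic d α κ)‖ ≤
      d * m * √(RCLike.re (inner ℂ (L (polyToHardy 1)) (polyToHardy 1))) := by
  obtain ⟨R, hR⟩ := ContinuousLinearMap.exists_norm_sq_eq_of_nonneg hL.1.1
  have hRz : ∀ i f, ‖R (mulZ i f)‖ ≤ ‖R f‖ := fun i f => by
    have := re_inner_mulZ_le_of_mem_coneLc hL.1 i f
    rw [hR, hR] at this
    exact le_of_sq_le_sq this (norm_nonneg _)
  have h1 : ‖inner ℂ g (hardyQuadratic d α κ)‖ ≤ ‖R (hardyQuadratic d α κ)‖ := by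
    have := norm_inner_sq_le_of_rankOne_le hL.2 (hardyQuadratic d α κ)
    rw [hR] at this
    exact le_of_sq_le_sq this (norm_nonneg _)
  rw [hR, Real.sqrt_sq (norm_nonneg _)]
  refine h1.trans ?_
  calc ‖R (hardyQuadratic d α κ)‖
      ≤ ∑ i, ‖α • R (hardyX i) + κ • ∑ j, R (hardyX j)‖ := by
        rw [hardyQuadratic, map_sum]
        refine norm_sum_le_of_le _ fun i _ => (hRz i _).trans_eq ?_
        simp only [map_add, map_smul, map_sum]
    _ ≤ _ := sum_norm_smul_add_smul_sum_le hd _ hα hβ (norm_nonneg _) fun i => hRz i _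

lemma exists_norm_one_mul_eq_norm (z : ℂ) : ∃ α : ℂ, ‖α‖ = 1 ∧ α * z = ‖z‖ := by
  by_cases hz : z = 0
  · exact ⟨1, by simp [hz]⟩
  · have hz' : (‖z‖ : ℂ) ≠ 0 := by simpa using hz
    refine ⟨starRingEnd ℂ z / ‖z‖, by simp [hz], ?_⟩
    rw [div_mul_eq_mul_div, Complex.conj_mul']
    field_simp

lemma inner_hardyQuadratic_hardyQuadratic (t α κ : ℂ) :
    inner ℂ (hardyQuadratic d (1 - t / 2) (t / 2)) (hardyQuadratic d α κ) =
      d * (starRingEnd ℂ (1 - t) * (α + κ) + starRingEnd ℂ t * (α + d * κ)) := by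
  have hc : ∀ i j, (α • hardyX i + κ • ∑ k, hardyX k : HardySpace d) (Finsupp.single j 1) =
      (if j = i then α else 0) + κ := fun i j => by
    have h1 : ∀ k : Fin d, inner ℂ (hardyX j) (hardyX k) = if j = k then (1 : ℂ) else 0 :=
      fun k => by
        conv_lhs => rw [hardyX, hardyX, ← hardyX, inner_hardyX_mulZ, ← inner_one_left,
          polyToHardy_one, lp.inner_single_left]
        simp
    rw [← inner_hardyX_left]
    simp [inner_add_right, inner_smul_right, inner_sum, h1]
  conv_lhs => rw [hardyQuadratic.eq_1 d α κ, inner_sum]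
  simp only [inner_hardyQuadratic_mulZ, hc, Finset.sum_add_distrib, Finset.sum_ite_eq',
    Finset.mem_univ, if_true, Finset.sum_const, Finset.card_univ, Fintype.card_fin,
    nsmul_eq_mul]
  have h2 : (1 - t / 2 - t / 2 : ℂ) = 1 - t := by ring
  have h3 : 2 * (t / 2) = t := by ring
  rw [h2, h3]
  ring

lemma le_sqrt_of_mem_coneLcAbove (hd : d ≠ 0) (t : ℂ) {L : HardySpace d →L[ℂ] HardySpace d}
    (hL : L ∈ coneLcAbove (polyToHardy (kvhPoly d t))) :
    ((d - 1) * ‖t - 1‖ + ‖(d - 1) * t + 1‖) / d ≤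
      √(RCLike.re (inner ℂ (L (polyToHardy 1)) (polyToHardy 1))) := by
  have hd' : (d : ℂ) ≠ 0 := by exact_mod_cast hd
  have hd0 : (0 : ℝ) < d := by positivity
  have hd1 : (1 : ℝ) ≤ d := by exact_mod_cast Nat.one_le_iff_ne_zero.2 hd
  -- The phases `α` (multiplicity `d - 1`) and `β` (multiplicity one) are the eigenvalues of the
  -- test form. They align with `1 - t` and `(d - 1)t + 1`, the eigenvalues of the matrix with
  -- diagonal `1` and off-diagonal `t`; `κ = (β - α)/d` realizes them.
  obtain ⟨α, hα, hα'⟩ := exists_norm_one_mul_eq_norm (starRingEnd ℂ (1 - t))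
  obtain ⟨β, hβ, hβ'⟩ := exists_norm_one_mul_eq_norm (starRingEnd ℂ ((d - 1) * t + 1))
  have hs : α + d * ((β - α) / d) = β := by field_simp; ring
  have h := norm_inner_hardyQuadratic_le hd hL hα.le (κ := (β - α) / d) (hs.symm ▸ hβ.le)
  rw [polyToHardy_kvhPoly, inner_hardyQuadratic_hardyQuadratic, hs] at h
  have h2 : (d : ℂ) * (starRingEnd ℂ (1 - t) * (α + (β - α) / d) + starRingEnd ℂ t * β) =
      (((d - 1) * ‖t - 1‖ + ‖(d - 1) * t + 1‖ : ℝ) : ℂ) := by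
    rw [RCLike.norm_conj, norm_sub_rev] at hα'
    rw [RCLike.norm_conj] at hβ'
    push_cast
    rw [← hα', ← hβ']
    simp only [map_add, map_mul, map_sub, map_one, map_natCast]
    field_simp
    ring
  rw [h2, Complex.norm_real, Real.norm_of_nonneg
    (add_nonneg (mul_nonneg (by linarith) (norm_nonneg _)) (norm_nonneg _))] at h
  rw [div_le_iff₀ hd0]
  linarith

/-! ### Upper bound for the dual norm: the estimates behind the extremal operator. -/

lemma card_mul_norm_sq_le_of_sum_eq_zero (x : Fin d → ℂ) (hx : ∑ i, x i = 0) (i : Fin d) :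
    d * ‖x i‖ ^ 2 ≤ (d - 1) * ∑ j, ‖x j‖ ^ 2 := by
  have hd1 : 1 ≤ d := i.pos
  rw [← Finset.add_sum_erase _ _ (Finset.mem_univ i)] at hx ⊢
  -- Cauchy–Schwarz over only the `d - 1` other entries yields the sharp factor `d - 1`.
  have h1 : ‖x i‖ ≤ ∑ j ∈ Finset.univ.erase i, ‖x j‖ := by
    rw [eq_neg_of_add_eq_zero_left hx, norm_neg]
    exact norm_sum_le _ _
  have h2 := sq_sum_le_card_mul_sum_sq (s := Finset.univ.erase i) (f := fun j => ‖x j‖)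
  have h3 := pow_le_pow_left₀ (norm_nonneg _) h1 2
  simp only [Finset.card_erase_of_mem (Finset.mem_univ i), Finset.card_univ, Fintype.card_fin,
    Nat.cast_sub hd1, Nat.cast_one] at h2
  linarith

lemma norm_mul_add_mul_sq_le (x : Fin d → ℂ) (hx : ∑ i, x i = 0) (i : Fin d) (l m s : ℂ) :
    ‖l * x i + m * s‖ ^ 2 ≤ ((d - 1) * ‖l‖ + ‖m‖) / d *
      (‖l‖ * ∑ j, ‖x j‖ ^ 2 + ‖m‖ * d * ‖s‖ ^ 2) := by
  have hd0 : (0 : ℝ) < d := by exact_mod_cast i.pos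
  have hd1 : (1 : ℝ) ≤ d := by exact_mod_cast i.pos
  have h := card_mul_norm_sq_le_of_sum_eq_zero x hx i
  have hX : 0 ≤ ∑ j, ‖x j‖ ^ 2 := by positivity
  set X := ∑ j, ‖x j‖ ^ 2
  have h1 : ‖l * x i + m * s‖ ≤ ‖l‖ * ‖x i‖ + ‖m‖ * ‖s‖ := by
    simpa using norm_add_le (l * x i) (m * s)
  -- AM–GM for the cross term, after bounding `d ‖x i‖ ^ 2` by `(d - 1) X`.
  have h2 : 2 * d * (‖x i‖ * ‖s‖) ≤ d * (d - 1) * ‖s‖ ^ 2 + X := by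
    refine abs_le_of_sq_le_sq' ?_ ?_ |>.2
    · calc (2 * d * (‖x i‖ * ‖s‖)) ^ 2 = 4 * d * ‖s‖ ^ 2 * (d * ‖x i‖ ^ 2) := by ring
        _ ≤ 4 * d * ‖s‖ ^ 2 * ((d - 1) * X) := by gcongr
        _ ≤ _ := by linarith [sq_nonneg (d * (d - 1) * ‖s‖ ^ 2 - X)]
    · have : (0 : ℝ) ≤ d - 1 := by linarith
      positivity
  rw [div_mul_eq_mul_div, le_div_iff₀ hd0]
  calc ‖l * x i + m * s‖ ^ 2 * d ≤ (‖l‖ * ‖x i‖ + ‖m‖ * ‖s‖) ^ 2 * d := by gcongr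
    _ = ‖l‖ ^ 2 * (d * ‖x i‖ ^ 2) + ‖l‖ * ‖m‖ * (2 * d * (‖x i‖ * ‖s‖)) +
        d * ‖m‖ ^ 2 * ‖s‖ ^ 2 := by ring
    _ ≤ ‖l‖ ^ 2 * ((d - 1) * X) + ‖l‖ * ‖m‖ * (d * (d - 1) * ‖s‖ ^ 2 + X) +
        d * ‖m‖ ^ 2 * ‖s‖ ^ 2 := by gcongr
    _ = _ := by ring

end Hardy

/-! ### The extremal operator and the value of the dual norm. -/

section DualNorm

variable {d : ℕ}

lemma ContinuousLinearMap.IsPositive.ofReal_smul {H : Type*} [NormedAddCommGroup H]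
    [InnerProductSpace ℂ H] {T : H →L[ℂ] H} (hT : T.IsPositive) {r : ℝ} (hr : 0 ≤ r) :
    ((r : ℂ) • T).IsPositive := by
  open scoped ComplexOrder in
  exact hT.smul_of_nonneg (by exact_mod_cast hr)

/-- The function `z_i - (z_1 + ⋯ + z_d) / d` in the Hardy space. -/
noncomputable def centeredX (i : Fin d) : HardySpace d :=
  hardyX i - (d : ℂ)⁻¹ • ∑ j, hardyX j

open InnerProductSpace in
/-- The operator `a ∑ w_i ⊗ w_i + b s ⊗ s + c 1 ⊗ 1` with `w_i = z_i - s / d`, `s = ∑ z_i`. -/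
noncomputable def lowDegreeOperator (d : ℕ) (a b c : ℝ) : HardySpace d →L[ℂ] HardySpace d :=
  (a : ℂ) • ∑ i, rankOne ℂ (centeredX i) (centeredX i) +
    (b : ℂ) • rankOne ℂ (∑ i, hardyX i) (∑ i, hardyX i) +
    (c : ℂ) • rankOne ℂ (polyToHardy 1) (polyToHardy 1)

lemma isPositive_lowDegreeOperator {a b c : ℝ} (ha : 0 ≤ a) (hb : 0 ≤ b) (hc : 0 ≤ c) :
    (lowDegreeOperator d a b c).IsPositive :=
  (((ContinuousLinearMap.isPositive_sum _ fun _ _ =>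
    InnerProductSpace.isPositive_rankOne_self _).ofReal_smul ha).add
    ((InnerProductSpace.isPositive_rankOne_self _).ofReal_smul hb)).add
    ((InnerProductSpace.isPositive_rankOne_self _).ofReal_smul hc)

lemma re_inner_ofReal_smul_apply {H : Type*} [NormedAddCommGroup H] [InnerProductSpace ℂ H]
    (r : ℝ) (T : H →L[ℂ] H) (f : H) :
    RCLike.re (inner ℂ (((r : ℂ) • T) f) f) = r * RCLike.re (inner ℂ (T f) f) := by
  simp

lemma re_inner_lowDegreeOperator (a b c : ℝ) (f : HardySpace d) :
    RCLike.re (inner ℂ (lowDegreeOperator d a b c f) f) =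
      a * ∑ i, ‖inner ℂ (centeredX i) f‖ ^ 2 + b * ‖∑ i, inner ℂ (hardyX i) f‖ ^ 2 +
        c * ‖f 0‖ ^ 2 := by
  rw [lowDegreeOperator, add_apply, add_apply, inner_add_left, inner_add_left, map_add, map_add,
    re_inner_ofReal_smul_apply, re_inner_ofReal_smul_apply, re_inner_ofReal_smul_apply,
    re_inner_rankOne_self, re_inner_rankOne_self, sum_apply, sum_inner, map_sum, sum_inner,
    inner_one_left]
  simp only [re_inner_rankOne_self]

lemma inner_centeredX (i : Fin d) (f : HardySpace d) :
    inner ℂ (centeredX i) f = f (Finsupp.single i 1) -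
      (d : ℂ)⁻¹ • ∑ j, f (Finsupp.single j 1) := by
  simp [centeredX, inner_sub_left, inner_smul_left, sum_inner, inner_hardyX_left, mul_comm]

/-- Only the degree-one terms see `z_i f`, through `f 0` alone; `(d - 1)/d` is the squared norm of
`centeredX i`. -/
lemma re_inner_lowDegreeOperator_mulZ (hd : d ≠ 0) (a b c : ℝ) (i : Fin d) (f : HardySpace d) :
    RCLike.re (inner ℂ (lowDegreeOperator d a b c (mulZ i f)) (mulZ i f)) =
      (a * (d - 1) / d + b) * ‖f 0‖ ^ 2 := by
  have hd0 : (d : ℝ) ≠ 0 := by exact_mod_cast hd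
  have h0 : mulZ i f 0 = 0 := by rw [← inner_one_left, inner_one_mulZ]
  have h1 : ∀ j : Fin d, mulZ i f (Finsupp.single j 1) = if j = i then f 0 else 0 := fun j => by
    rw [← inner_hardyX_left, inner_hardyX_mulZ]
  have h2 : ∑ j : Fin d, ‖(if j = i then f 0 else 0) - (d : ℂ)⁻¹ • f 0‖ ^ 2 =
      (d - 1) / d * ‖f 0‖ ^ 2 := by
    have h3 : ∀ j : Fin d, ‖(if j = i then f 0 else 0) - (d : ℂ)⁻¹ • f 0‖ ^ 2 =
        ((if j = i then 1 - 2 * (d : ℝ)⁻¹ else 0) + (d : ℝ)⁻¹ ^ 2) * ‖f 0‖ ^ 2 := fun j => by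
      split_ifs
      · have : f 0 - (d : ℂ)⁻¹ • f 0 = ((1 - (d : ℝ)⁻¹ : ℝ) : ℂ) * f 0 := by
          push_cast; rw [smul_eq_mul]; ring
        rw [this, norm_mul, mul_pow, Complex.norm_real, Real.norm_eq_abs, sq_abs]
        ring
      · simp [mul_pow]
    simp only [h3, ← Finset.sum_mul, Finset.sum_add_distrib, Finset.sum_ite_eq', Finset.mem_univ,
      if_true, Finset.sum_const, Finset.card_univ, Fintype.card_fin, nsmul_eq_mul]
    field_simp
    ring
  simp only [re_inner_lowDegreeOperator, inner_centeredX, inner_hardyX_left, h0, h1,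
    Finset.sum_ite_eq', Finset.mem_univ, if_true, h2, norm_zero]
  ring

/-- This is the degree-two to degree-one part of `M_{z_i}^* L M_{z_i} ≤ L`. -/
lemma norm_inner_mulZ_sq_le (hd : d ≠ 0) (t : ℂ) (i : Fin d) (f : HardySpace d) :
    ‖inner ℂ (polyToHardy (kvhPoly d t)) (mulZ i f)‖ ^ 2 ≤
      ((d - 1) * ‖t - 1‖ + ‖(d - 1) * t + 1‖) / d *
        (‖t - 1‖ * ∑ j, ‖inner ℂ (centeredX j) f‖ ^ 2 +
          ‖(d - 1) * t + 1‖ / d * ‖∑ j, inner ℂ (hardyX j) f‖ ^ 2) := by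
  have hd0 : (d : ℂ) ≠ 0 := by exact_mod_cast hd
  have hx := sum_sub_mean hd fun j => f (Finsupp.single j 1)
  have h := norm_mul_add_mul_sq_le _ hx i (starRingEnd ℂ (1 - t))
    (starRingEnd ℂ ((d - 1) * t + 1)) ((d : ℂ)⁻¹ • ∑ j, f (Finsupp.single j 1))
  rw [RCLike.norm_conj, RCLike.norm_conj, norm_sub_rev] at h
  simp only [inner_centeredX, inner_hardyX_left]
  rw [polyToHardy_kvhPoly, inner_hardyQuadratic_mulZ]
  convert h using 2
  · congr 1
    have h2 : (1 - t / 2 - t / 2 : ℂ) = 1 - t := by ring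
    have h3 : 2 * (t / 2) = t := by ring
    rw [h2, h3]
    simp only [map_add, map_mul, map_sub, map_one, map_natCast, smul_eq_mul]
    field_simp
    ring
  · have : (d : ℝ) ≠ 0 := by exact_mod_cast hd
    rw [norm_smul, norm_inv, Complex.norm_natCast]
    field_simp

lemma polyToHardy_kvhPoly_apply_zero (t : ℂ) : polyToHardy (kvhPoly d t) 0 = 0 := by
  rw [← inner_one_left, polyToHardy_kvhPoly, hardyQuadratic, inner_sum]
  exact Finset.sum_eq_zero fun i _ => inner_one_mulZ i _

lemma exists_mem_coneLcAbove_sqrt_eq (hd : d ≠ 0) (t : ℂ) :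
    ∃ L ∈ coneLcAbove (polyToHardy (kvhPoly d t)),
      √(RCLike.re (inner ℂ (L (polyToHardy 1)) (polyToHardy 1))) =
        ((d - 1) * ‖t - 1‖ + ‖(d - 1) * t + 1‖) / d := by
  have hd1 : (0 : ℝ) ≤ d - 1 := by
    have : (1 : ℝ) ≤ d := by exact_mod_cast Nat.one_le_iff_ne_zero.2 hd
    linarith
  have hd0 : (d : ℝ) ≠ 0 := by exact_mod_cast hd
  set c := ((d - 1) * ‖t - 1‖ + ‖(d - 1) * t + 1‖) / (d : ℝ) with hc
  have hc0 : 0 ≤ c := by positivity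
  set g := polyToHardy (kvhPoly d t)
  -- The degree-one weights come from `norm_inner_mulZ_sq_le`. Compressing them by `M_{z_i}`
  -- produces exactly `c ^ 2` in degree zero, which is `⟨L 1, 1⟩`.
  set K := lowDegreeOperator d (c * ‖t - 1‖) (c * (‖(d - 1) * t + 1‖ / d)) (c ^ 2) with hK
  have hKpos : K.IsPositive :=
    isPositive_lowDegreeOperator (by positivity) (by positivity) (by positivity)
  have hLpos := (InnerProductSpace.isPositive_rankOne_self (𝕜 := ℂ) g).add hKpos
  refine ⟨InnerProductSpace.rankOne ℂ g g + K, ⟨⟨?_, fun i => ?_⟩, ?_⟩, ?_⟩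
  · rwa [ContinuousLinearMap.nonneg_iff_isPositive]
  · rw [ContinuousLinearMap.le_def, ContinuousLinearMap.isPositive_def']
    refine ⟨hLpos.isSelfAdjoint.sub (hLpos.adjoint_conj (mulZ i)).isSelfAdjoint, fun f => ?_⟩
    rw [ContinuousLinearMap.reApplyInnerSelf_apply, sub_apply, inner_sub_left, map_sub,
      sub_nonneg, ContinuousLinearMap.comp_apply, ContinuousLinearMap.adjoint_inner_left,
      ContinuousLinearMap.comp_apply, add_apply, add_apply, inner_add_left, inner_add_left,
      map_add, map_add, re_inner_rankOne_self, re_inner_rankOne_self, hK,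
      re_inner_lowDegreeOperator_mulZ hd, re_inner_lowDegreeOperator]
    have h1 := norm_inner_mulZ_sq_le hd t i f
    have h2 : c * ‖t - 1‖ * (d - 1) / d + c * (‖(d - 1) * t + 1‖ / d) = c ^ 2 := by
      rw [hc]; ring
    rw [h2]
    linarith [sq_nonneg ‖inner ℂ g f‖]
  · rwa [ContinuousLinearMap.le_def, add_sub_cancel_left]
  · have h1 : (polyToHardy 1 : HardySpace d) 0 = 1 := by simp [polyToHardy_one]
    have h2 : ∀ i : Fin d, (polyToHardy 1 : HardySpace d) (Finsupp.single i 1) = 0 := fun i => by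
      simp [polyToHardy_one]
    have h3 : inner ℂ g (polyToHardy 1) = 0 := by
      rw [← inner_conj_symm, inner_one_left, polyToHardy_kvhPoly_apply_zero, map_zero]
    rw [add_apply, inner_add_left, map_add, re_inner_rankOne_self, re_inner_lowDegreeOperator, h3]
    simp [inner_centeredX, inner_hardyX_left, h1, h2, Real.sqrt_sq hc0]

lemma dualSchurAglerNorm_kvhPoly (hd : d ≠ 0) (t : ℂ) :
    dualSchurAglerNorm (polyToHardy (kvhPoly d t)) =
      ((d - 1) * ‖t - 1‖ + ‖(d - 1) * t + 1‖) / d := by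
  refine IsLeast.csInf_eq ⟨exists_mem_coneLcAbove_sqrt_eq hd t, ?_⟩
  rintro _ ⟨L, hL, rfl⟩
  exact le_sqrt_of_mem_coneLcAbove hd t hL

end DualNorm

theorem mainTheorem7 (d : ℕ) (hd : 1 ≤ d) (t : ℂ) :
    (2 ≤ d → schurAglerNorm.{u} (kvhPoly d t) =
      ENNReal.ofReal (d * max ‖1 - t / 2‖ ‖1 + t * (d - 1) / 2‖)) ∧
    dualSchurAglerNorm (polyToHardy (kvhPoly d t)) =
      ((d - 1) * ‖t - 1‖ + ‖(d - 1) * t + 1‖) / d :=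
  ⟨fun h => schurAglerNorm_kvhPoly h t, dualSchurAglerNorm_kvhPoly (by omega) t⟩
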